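/- Let $d\ge 2$ be an integer, let $p\in[1,\infty)$, and let $\mathcal H$ be a set of functions $\mathbb R^{d-1}\to\mathbb R$ such that (a) every $h\in\mathcal H$ is piecewise $C^1$: $h$ is measurable and there is an at most countable family $(V_i)_{i\in I}$ of pairwise disjoint open subsets of $\mathbb R^{d-1}$ such that $\mathbb R^{d-1}\setminus\bigcup_i V_i$ is a Lebesgue null set, each compact set meets only finitely many of the $V_i$, and for each $i$ there are an open set $W_i\supset\overline{V_i}$ and a $C^1$ function $\tilde h_i:W_i\to\mathbb R$ with $\tilde h_i=h$ on $V_i$; (b) $\mathcal H$ is a $\sup$-universal approximator for $C_c^\infty(\mathbb R^{d-1})$: for every compactly supported $C^\infty$ function $f:\mathbb R^{d-1}\to\mathbb R$, every $\varepsilon>0$ and every compact $K\subset\mathbb R^{d-1}$ there is $h\in\mathcal H$ with $\sup_{x\in K}|f(x)-h(x)|<\varepsilon$. For $s,t\in\mathcal H$ let $\Psi_{s,t}:\mathbb R^d\to\mathbb R^d$, $\Psi_{s,t}(x,y)=(x,\,y\,e^{s(x)}+t(x))$ for $x\in\mathbb R^{d-1}$, $y\in\mathbb R$. Let $\mathrm{INN}_{\mathcal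 H\text{-}\mathrm{ACF}}$ be the set of all maps $W_1\circ g_1\circ\cdots\circ W_n\circ g_n$ with $n\ge 1$, each $g_i=\Psi_{s_i,t_i}$ with $s_i,t_i\in\mathcal H$, and each $W_i$ an invertible affine transformation of $\mathbb R^d$. Let $\mathcal S^0$ be the set of all homeomorphisms $\tau:\mathbb R^d\to\mathbb R^d$ that equal the identity outside some compact set and alter only the last coordinate, i.e. $\tau(x)=(x_1,\dots,x_{d-1},\tau_d(x))$. Then $\mathrm{INN}_{\mathcal H\text{-}\mathrm{ACF}}$ is an $L^p$-universal approximator for $\mathcal S^0$: its elements are measurable, and for every $f\in\mathcal S^0$, every $\varepsilon>0$ and every compact $K\subset\mathbb R^d$ there is $g\in\mathrm{INN}_{\mathcal H\text{-}\mathrm{ACF}}$ with $\left(\int_K\|f(x)-g(x)\|^p\,dx\right)^{1/p}<\varepsilon$, where $\|\cdot\|$ is the Euclidean norm. -/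

import Mathlib

open MeasureTheory
open scoped ENNReal ContDiff

noncomputable section

/-- The vector `(x₁, …, x_m)` of the first `m` coordinates of `x ∈ ℝ^(m+1)`. -/
def firstCoords {m : ℕ} (x : EuclideanSpace ℝ (Fin (m + 1))) : EuclideanSpace ℝ (Fin m) :=
  WithLp.toLp 2 fun i => x i.castSucc

/-- The affine coupling flow on `ℝ^(m+1)` that acts on the last coordinate only:
`(x', y) ↦ (x', y * exp (s x') + t x')` with `x' ∈ ℝ^m` and `y ∈ ℝ`. -/
def affineCoupling {m : ℕ} (s t : EuclideanSpace ℝ (Fin m) → ℝ)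
    (x : EuclideanSpace ℝ (Fin (m + 1))) : EuclideanSpace ℝ (Fin (m + 1)) :=
  WithLp.toLp 2 (Fin.snoc (α := fun _ => ℝ) (fun i : Fin m => x i.castSucc)
    (x (Fin.last m) * Real.exp (s (firstCoords x)) + t (firstCoords x)))

/-- The `H`-single-coordinate affine coupling flows. -/
def singleCoordACF {m : ℕ} (H : Set (EuclideanSpace ℝ (Fin m) → ℝ)) :
    Set (EuclideanSpace ℝ (Fin (m + 1)) → EuclideanSpace ℝ (Fin (m + 1))) :=
  {g | ∃ s ∈ H, ∃ t ∈ H, g = affineCoupling s t}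

/-- The invertible affine transforms `x ↦ A x + b` of `ℝ^d`. -/
def affineTransforms (d : ℕ) : Set (EuclideanSpace ℝ (Fin d) → EuclideanSpace ℝ (Fin d)) :=
  {W | ∃ (A : EuclideanSpace ℝ (Fin d) ≃ₗ[ℝ] EuclideanSpace ℝ (Fin d))
    (b : EuclideanSpace ℝ (Fin d)), W = fun x => A x + b}

/-- `IsINN G f` : the map `f` is of the form `W₁ ∘ g₁ ∘ ⋯ ∘ Wₙ ∘ gₙ` with `n ≥ 1`,
`gᵢ ∈ G` and `Wᵢ` invertible affine transforms. -/
inductive IsINN {d : ℕ} (G : Set (EuclideanSpace ℝ (Fin d) → EuclideanSpace ℝ (Fin d))) :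
    (EuclideanSpace ℝ (Fin d) → EuclideanSpace ℝ (Fin d)) → Prop
  | single {W g : EuclideanSpace ℝ (Fin d) → EuclideanSpace ℝ (Fin d)}
      (hW : W ∈ affineTransforms d) (hg : g ∈ G) : IsINN G (W ∘ g)
  | cons {W g f : EuclideanSpace ℝ (Fin d) → EuclideanSpace ℝ (Fin d)}
      (hW : W ∈ affineTransforms d) (hg : g ∈ G) (hf : IsINN G f) : IsINN G (W ∘ g ∘ f)

/-- The set of invertible neural networks based on `G`. -/
def INN {d : ℕ} (G : Set (EuclideanSpace ℝ (Fin d) → EuclideanSpace ℝ (Fin d))) :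
    Set (EuclideanSpace ℝ (Fin d) → EuclideanSpace ℝ (Fin d)) :=
  {f | IsINN G f}

/-- `M` is a set of measurable maps such that for every `f ∈ F`, `ε > 0` and compact `K` there is
`g ∈ M` with `(∫_K ‖f x - g x‖ ^ p dx) ^ (1 / p) < ε` (the integral is `[0, ∞]`-valued). -/
def IsLpUniversal {m n : ℕ} (p : ℝ)
    (M F : Set (EuclideanSpace ℝ (Fin m) → EuclideanSpace ℝ (Fin n))) : Prop :=
  (∀ g ∈ M, Measurable g) ∧
    ∀ f ∈ F, ∀ ε : ℝ, 0 < ε → ∀ K : Set (EuclideanSpace ℝ (Fin m)), IsCompact K →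
      ∃ g ∈ M, eLpNorm (fun x => f x - g x) (ENNReal.ofReal p) (volume.restrict K)
        < ENNReal.ofReal ε

/-- `M` is a set of measurable real-valued functions such that for every `f ∈ F`, `ε > 0` and
compact `K` there is `g ∈ M` with `sup_{x ∈ K} |f x - g x| < ε`
(the supremum is `[0, ∞]`-valued). -/
def IsSupUniversal {m : ℕ} (M F : Set (EuclideanSpace ℝ (Fin m) → ℝ)) : Prop :=
  (∀ g ∈ M, Measurable g) ∧
    ∀ f ∈ F, ∀ ε : ℝ, 0 < ε → ∀ K : Set (EuclideanSpace ℝ (Fin m)), IsCompact K →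
      ∃ g ∈ M, ⨆ x ∈ K, ‖f x - g x‖ₑ < ENNReal.ofReal ε

/-- The compactly supported `C^∞` functions `ℝ^m → ℝ`. -/
def smoothCompactlySupported (m : ℕ) : Set (EuclideanSpace ℝ (Fin m) → ℝ) :=
  {f | ContDiff ℝ ∞ f ∧ HasCompactSupport f}

/-- Piecewise `C^1` functions `ℝ^m → ℝ`: measurable functions that, on each piece `V i` of a
countable, locally finite family of pairwise disjoint open sets covering almost all of `ℝ^m`,
agree with a function that is `C^1` on an open neighbourhood `W` of the closure of `V i`. -/
def IsPiecewiseC1 {m : ℕ} (f : EuclideanSpace ℝ (Fin m) → ℝ) : Prop :=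
  Measurable f ∧
    ∃ (ι : Type) (_ : Countable ι) (V : ι → Set (EuclideanSpace ℝ (Fin m))),
      (∀ i, IsOpen (V i)) ∧
      (∀ i j, i ≠ j → Disjoint (V i) (V j)) ∧
      volume (⋃ i, V i)ᶜ = 0 ∧
      (∀ i, ∃ (W : Set (EuclideanSpace ℝ (Fin m))) (fi : EuclideanSpace ℝ (Fin m) → ℝ),
        IsOpen W ∧ closure (V i) ⊆ W ∧ ContDiffOn ℝ 1 fi W ∧ Set.EqOn fi f (V i)) ∧
      ∀ K : Set (EuclideanSpace ℝ (Fin m)), IsCompact K → {i | (V i ∩ K).Nonempty}.Finite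

/-- The homeomorphisms of `ℝ^(m+1)` that are the identity outside some compact set and that
alter only the last coordinate. -/
def singleCoordHomeos (m : ℕ) :
    Set (EuclideanSpace ℝ (Fin (m + 1)) → EuclideanSpace ℝ (Fin (m + 1))) :=
  {τ | IsHomeomorph τ ∧ (∀ x, ∀ i : Fin m, τ x i.castSucc = x i.castSucc) ∧
    ∃ K : Set (EuclideanSpace ℝ (Fin (m + 1))), IsCompact K ∧ ∀ x, x ∉ K → τ x = x}

end

/-! ### Couplings, and stability of uniform approximation under composition -/

section Coupling

variable {m : ℕ}

/-! A homeomorphism `τ` in the class is increasing in the last coordinate `y` on every vertical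
line. Cut space into small cubes and replace `τ`, on the column of cubes over the cell `X j` of
`x'`, by the piecewise linear interpolation in `y` of its values above one corner of that cell. On
the cube `X j × I i` this is an affine map of `y` with positive slope, so a coupling could perform
it if its coefficients could depend on `y` as well as on `x'`.

A network achieves this dependence by encoding the cube index in coordinates
(`exists_INN_piecewise_affine`). Add `M j` to `y`, with the `M j` far apart: `y` alone now
determines `(i, j)`. Add `c (i, j)` to one coordinate of `x'`: `x'` alone now determines `(i, j)`,
and a coupling can apply the right affine map. Then undo both shifts. The first is undone by reading
`(i, j)` off the new `y`, which is possible because monotonicity keeps the images of the `I i`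
disjoint.

The coefficients are smooth functions, locally constant in value only on cubes shrunk to be
disjoint, so the network is wrong near the grid. There it is bounded by a constant independent of
the shrinking, and the bad set has measure tending to zero, so the `L^p` error is small
(`exists_eLpNorm_lt`). Finally, smooth couplings are replaced by couplings from `H`, uniformly on
compact sets (`exists_INN_approx`). -/

@[simp]
theorem firstCoords_apply (x : EuclideanSpace ℝ (Fin (m + 1))) (i : Fin m) :
    firstCoords x i = x i.castSucc := rfl

@[simp]
theorem affineCoupling_castSucc (s t : EuclideanSpace ℝ (Fin m) → ℝ)
    (x : EuclideanSpace ℝ (Fin (m + 1))) (i : Fin m) :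
    affineCoupling s t x i.castSucc = x i.castSucc := by
  simp [affineCoupling]

@[simp]
theorem affineCoupling_last (s t : EuclideanSpace ℝ (Fin m) → ℝ)
    (x : EuclideanSpace ℝ (Fin (m + 1))) :
    affineCoupling s t x (Fin.last m)
      = x (Fin.last m) * Real.exp (s (firstCoords x)) + t (firstCoords x) := by
  simp [affineCoupling]

theorem continuous_firstCoords : Continuous (firstCoords (m := m)) := by
  unfold firstCoords
  fun_prop

theorem measurable_affineCoupling {s t : EuclideanSpace ℝ (Fin m) → ℝ}
    (hs : Measurable s) (ht : Measurable t) : Measurable (affineCoupling s t) := by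
  have hf : Measurable (firstCoords (m := m)) := continuous_firstCoords.measurable
  refine (WithLp.measurable_toLp 2 _).comp (measurable_pi_iff.2 fun k => ?_)
  refine Fin.lastCases ?_ (fun i => ?_) k
  · simp only [Fin.snoc_last]
    have : Measurable fun x : EuclideanSpace ℝ (Fin (m + 1)) => x (Fin.last m) :=
      (by fun_prop : Continuous _).measurable
    exact (this.mul (Real.measurable_exp.comp (hs.comp hf))).add (ht.comp hf)
  · simp only [Fin.snoc_castSucc]
    exact (by fun_prop : Continuous _).measurable

theorem continuous_affineCoupling {s t : EuclideanSpace ℝ (Fin m) → ℝ}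
    (hs : Continuous s) (ht : Continuous t) : Continuous (affineCoupling s t) := by
  have hf := continuous_firstCoords (m := m)
  refine (PiLp.continuous_toLp 2 _).comp (continuous_pi fun k => ?_)
  refine Fin.lastCases ?_ (fun i => ?_) k
  · simp only [Fin.snoc_last]
    fun_prop
  · simp only [Fin.snoc_castSucc]
    fun_prop

theorem continuous_of_mem_affineTransforms {d : ℕ}
    {W : EuclideanSpace ℝ (Fin d) → EuclideanSpace ℝ (Fin d)} (hW : W ∈ affineTransforms d) :
    Continuous W := by
  obtain ⟨A, b, rfl⟩ := hW
  exact (LinearMap.continuous_of_finiteDimensional A.toLinearMap).add continuous_const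

theorem IsINN.measurable {d : ℕ} {G : Set (EuclideanSpace ℝ (Fin d) → EuclideanSpace ℝ (Fin d))}
    (hG : ∀ g ∈ G, Measurable g) {f : EuclideanSpace ℝ (Fin d) → EuclideanSpace ℝ (Fin d)}
    (hf : IsINN G f) : Measurable f := by
  induction hf with
  | single hW hg => exact (continuous_of_mem_affineTransforms hW).measurable.comp (hG _ hg)
  | cons hW hg _ ih =>
    exact (continuous_of_mem_affineTransforms hW).measurable.comp ((hG _ hg).comp ih)

theorem IsINN.continuous {d : ℕ} {G : Set (EuclideanSpace ℝ (Fin d) → EuclideanSpace ℝ (Fin d))}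
    (hG : ∀ g ∈ G, Continuous g) {f : EuclideanSpace ℝ (Fin d) → EuclideanSpace ℝ (Fin d)}
    (hf : IsINN G f) : Continuous f := by
  induction hf with
  | single hW hg => exact (continuous_of_mem_affineTransforms hW).comp (hG _ hg)
  | cons hW hg _ ih =>
    exact (continuous_of_mem_affineTransforms hW).comp ((hG _ hg).comp ih)

/-- Two maps that agree in the first `m` coordinates are as far apart as their last coordinates. -/
theorem dist_eq_abs_sub_last {x y : EuclideanSpace ℝ (Fin (m + 1))}
    (h : ∀ i : Fin m, x i.castSucc = y i.castSucc) :
    dist x y = |x (Fin.last m) - y (Fin.last m)| := by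
  rw [EuclideanSpace.dist_eq, Fin.sum_univ_castSucc]
  simp [h, Real.dist_eq, Real.sqrt_sq_eq_abs]

theorem IsSupUniversal.exists_forall_abs_sub_le {H F : Set (EuclideanSpace ℝ (Fin m) → ℝ)}
    (hH : IsSupUniversal H F) {f : EuclideanSpace ℝ (Fin m) → ℝ} (hf : f ∈ F) {ε : ℝ}
    (hε : 0 < ε) {K : Set (EuclideanSpace ℝ (Fin m))} (hK : IsCompact K) :
    ∃ g ∈ H, ∀ x ∈ K, |f x - g x| ≤ ε := by
  obtain ⟨g, hg, hlt⟩ := hH.2 f hf ε hε K hK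
  refine ⟨g, hg, fun x hx => ?_⟩
  have h1 : ‖f x - g x‖ₑ ≤ ENNReal.ofReal ε :=
    (le_iSup₂ (f := fun x (_ : x ∈ K) => ‖f x - g x‖ₑ) x hx).trans hlt.le
  rwa [← ofReal_norm, ENNReal.ofReal_le_ofReal_iff hε.le, Real.norm_eq_abs] at h1

/-- Factoring out `exp s` leaves `exp (s' - s) - 1`, which is at most `2 * |s' - s|` in absolute
value as long as `|s' - s| ≤ 1`; hence the condition `η ≤ 1`. -/
theorem abs_mul_exp_add_sub_le {y s s' t t' R S η : ℝ} (hy : |y| ≤ R) (hs : |s| ≤ S)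
    (hη : η ≤ 1) (h1 : |s - s'| ≤ η) (h2 : |t - t'| ≤ η) :
    |(y * Real.exp s + t) - (y * Real.exp s' + t')| ≤ (R * (Real.exp S * 2) + 1) * η := by
  have hη0 : 0 ≤ η := (abs_nonneg _).trans h1
  have e : Real.exp s - Real.exp s' = - (Real.exp s * (Real.exp (s' - s) - 1)) := by
    rw [mul_sub, ← Real.exp_add]; ring_nf
  have h3 : |Real.exp (s' - s) - 1| ≤ 2 * |s' - s| :=
    Real.abs_exp_sub_one_le (by rw [abs_sub_comm]; linarith)
  have h4 : |Real.exp s - Real.exp s'| ≤ Real.exp S * (2 * η) := by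
    rw [e, abs_neg, abs_mul, Real.abs_exp]
    have := abs_sub_comm s s'
    exact mul_le_mul (Real.exp_le_exp.2 ((le_abs_self s).trans hs)) (by linarith)
      (abs_nonneg _) (Real.exp_pos _).le
  calc _ = |y * (Real.exp s - Real.exp s') + (t - t')| := by ring_nf
    _ ≤ |y| * |Real.exp s - Real.exp s'| + |t - t'| := by
      rw [← abs_mul]; exact abs_add_le _ _
    _ ≤ R * (Real.exp S * (2 * η)) + η := by
      gcongr
      exact (abs_nonneg _).trans hy
    _ = _ := by ring

theorem exists_singleCoordACF_approx {H : Set (EuclideanSpace ℝ (Fin m) → ℝ)}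
    (hH : IsSupUniversal H (smoothCompactlySupported m))
    {g : EuclideanSpace ℝ (Fin (m + 1)) → EuclideanSpace ℝ (Fin (m + 1))}
    (hg : g ∈ singleCoordACF (smoothCompactlySupported m))
    {K : Set (EuclideanSpace ℝ (Fin (m + 1)))} (hK : IsCompact K) {ε : ℝ} (hε : 0 < ε) :
    ∃ g' ∈ singleCoordACF H, ∀ x ∈ K, dist (g x) (g' x) ≤ ε := by
  obtain ⟨s, hs, t, ht, rfl⟩ := hg
  obtain ⟨R, hR⟩ := hK.exists_bound_of_continuousOn (f := fun x => x (Fin.last m))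
    (by fun_prop)
  have hK' := hK.image (continuous_firstCoords (m := m))
  obtain ⟨S, hS⟩ := hK'.exists_bound_of_continuousOn hs.1.continuous.continuousOn
  -- A point of `K` is what forces `0 ≤ R`. For empty `K` any member of `H` serves.
  rcases K.eq_empty_or_nonempty with rfl | ⟨x0, hx0⟩
  · obtain ⟨s', hs', -⟩ := hH.exists_forall_abs_sub_le hs one_pos hK'
    exact ⟨_, ⟨s', hs', s', hs', rfl⟩, by simp⟩
  have hR0 : 0 ≤ R := (norm_nonneg _).trans (hR x0 hx0)
  have hc : 0 < R * (Real.exp S * 2) + 1 := by positivity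
  set η := min 1 (ε / (R * (Real.exp S * 2) + 1)) with hηd
  have hη : 0 < η := by positivity
  obtain ⟨s', hs', hss⟩ := hH.exists_forall_abs_sub_le hs hη hK'
  obtain ⟨t', ht', htt⟩ := hH.exists_forall_abs_sub_le ht hη hK'
  refine ⟨_, ⟨s', hs', t', ht', rfl⟩, fun x hx => ?_⟩
  have hx' := Set.mem_image_of_mem firstCoords hx
  rw [dist_eq_abs_sub_last (by simp), affineCoupling_last, affineCoupling_last]
  refine (abs_mul_exp_add_sub_le (hR x hx) (hS _ hx') (min_le_left _ _) (hss _ hx')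
    (htt _ hx')).trans ?_
  calc _ ≤ (R * (Real.exp S * 2) + 1) * (ε / (R * (Real.exp S * 2) + 1)) := by
        gcongr; exact min_le_right _ _
    _ = ε := by field_simp

/-- Uniform approximability on compact sets is stable under composition. -/
theorem exists_approx_comp {X Y Z : Type*} [PseudoMetricSpace X] [PseudoMetricSpace Y]
    [ProperSpace Y] [PseudoMetricSpace Z] {A : Set (Y → Z)} {B : Set (X → Y)} {f : Y → Z}
    {g : X → Y} (hf : Continuous f) (hg : Continuous g)
    (hfA : ∀ K, IsCompact K → ∀ ε : ℝ, 0 < ε → ∃ f' ∈ A, ∀ x ∈ K, dist (f x) (f' x) ≤ ε)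
    (hgB : ∀ K, IsCompact K → ∀ ε : ℝ, 0 < ε → ∃ g' ∈ B, ∀ x ∈ K, dist (g x) (g' x) ≤ ε)
    {K : Set X} (hK : IsCompact K) {ε : ℝ} (hε : 0 < ε) :
    ∃ f' ∈ A, ∃ g' ∈ B, ∀ x ∈ K, dist (f (g x)) (f' (g' x)) ≤ ε := by
  -- The perturbed points `g' x` must stay in a compact set fixed before `g'` is chosen. Since `f'`
  -- need not be continuous, the comparison goes through `f (g' x)`, using uniform continuity of `f`
  -- alone.
  have hL : IsCompact (Metric.cthickening 1 (g '' K)) := (hK.image hg).cthickening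
  obtain ⟨f', hf', hff⟩ := hfA _ hL (ε / 2) (by positivity)
  obtain ⟨δ, hδ, huc⟩ := Metric.uniformContinuousOn_iff.1
    (hL.uniformContinuousOn_of_continuous hf.continuousOn) (ε / 2) (by positivity)
  obtain ⟨g', hg', hgg⟩ := hgB K hK (min 1 (δ / 2)) (by positivity)
  refine ⟨f', hf', g', hg', fun x hx => ?_⟩
  have hd := hgg x hx
  have h1 : g x ∈ Metric.cthickening 1 (g '' K) :=
    Metric.self_subset_cthickening _ (Set.mem_image_of_mem g hx)
  have h2 : g' x ∈ Metric.cthickening 1 (g '' K) :=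
    Metric.mem_cthickening_of_dist_le _ (g x) _ _ (Set.mem_image_of_mem g hx)
      (by rw [dist_comm]; exact hd.trans (min_le_left _ _))
  have h3 := huc _ h1 _ h2 (by
    have := hd.trans (min_le_right _ _)
    linarith)
  have h4 := hff _ h2
  linarith [dist_triangle (f (g x)) (f (g' x)) (f' (g' x))]

theorem continuous_of_mem_singleCoordACF_smooth
    {g : EuclideanSpace ℝ (Fin (m + 1)) → EuclideanSpace ℝ (Fin (m + 1))}
    (hg : g ∈ singleCoordACF (smoothCompactlySupported m)) : Continuous g := by
  obtain ⟨s, hs, t, ht, rfl⟩ := hg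
  exact continuous_affineCoupling hs.1.continuous ht.1.continuous

/-- If `H` is a sup-universal approximator for `C_c^∞`, the networks with smooth couplings are
uniform limits on compact sets of networks with couplings from `H`. -/
theorem exists_INN_approx {H : Set (EuclideanSpace ℝ (Fin m) → ℝ)}
    (hH : IsSupUniversal H (smoothCompactlySupported m))
    {f : EuclideanSpace ℝ (Fin (m + 1)) → EuclideanSpace ℝ (Fin (m + 1))}
    (hf : IsINN (singleCoordACF (smoothCompactlySupported m)) f) :
    ∀ K, IsCompact K → ∀ ε : ℝ, 0 < ε →
      ∃ g ∈ INN (singleCoordACF H), ∀ x ∈ K, dist (f x) (g x) ≤ ε := by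
  induction hf with
  | @single W g hW hg =>
    intro K hK ε hε
    obtain ⟨f', rfl, g', hg', h⟩ := exists_approx_comp (A := {W})
      (continuous_of_mem_affineTransforms hW) (continuous_of_mem_singleCoordACF_smooth hg)
      (fun _ _ ε hε => ⟨W, rfl, by simp [hε.le]⟩)
      (fun K hK ε hε => exists_singleCoordACF_approx hH hg hK hε) hK hε
    exact ⟨_, IsINN.single hW hg', h⟩
  | @cons W g f hW hg hf ih =>
    intro K hK ε hε
    have hfc := hf.continuous fun _ => continuous_of_mem_singleCoordACF_smooth
    have hgc := continuous_of_mem_singleCoordACF_smooth hg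
    have hWc := continuous_of_mem_affineTransforms hW
    obtain ⟨_, ⟨g', hg', rfl⟩, f', hf', h⟩ := exists_approx_comp
      (A := {q | ∃ g' ∈ singleCoordACF H, q = W ∘ g'}) (hWc.comp hgc) hfc
      (fun K hK ε hε => by
        obtain ⟨_, rfl, g', hg', h⟩ := exists_approx_comp (A := {W}) hWc hgc
          (fun _ _ ε hε => ⟨W, rfl, by simp [hε.le]⟩)
          (fun K hK ε hε => exists_singleCoordACF_approx hH hg hK hε) hK hε
        exact ⟨_, ⟨g', hg', rfl⟩, h⟩) ih hK hε
    exact ⟨_, IsINN.cons hW hg' hf', h⟩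

end Coupling

/-! ### Networks with smooth couplings that are affine on each cube -/

section Smooth

variable {m : ℕ}

theorem zero_mem_smoothCompactlySupported :
    (0 : EuclideanSpace ℝ (Fin m) → ℝ) ∈ smoothCompactlySupported m :=
  ⟨contDiff_const, HasCompactSupport.zero⟩

/-- Prescribed values on finitely many disjoint compact sets are attained by a function in
`C_c^∞` that is bounded independently of the sets. -/
theorem exists_smooth_eq_on_compacts {κ : Type*} [Fintype κ]
    {X : κ → Set (EuclideanSpace ℝ (Fin m))} (hX : ∀ k, IsCompact (X k))
    (hd : Pairwise (Function.onFun Disjoint X)) (v : κ → ℝ) :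
    ∃ f ∈ smoothCompactlySupported m, (∀ k, ∀ z ∈ X k, f z = v k) ∧ ∀ z, |f z| ≤ ∑ k, |v k| := by
  classical
  obtain ⟨R, hR⟩ := (isCompact_iUnion hX).isBounded.subset_ball 0
  have key : ∀ k, ∃ φ : EuclideanSpace ℝ (Fin m) → ℝ, ContDiff ℝ ∞ φ ∧
      (∀ z ∈ X k, φ z = 1) ∧ (∀ l ≠ k, ∀ z ∈ X l, φ z = 0) ∧
      (∀ z ∉ Metric.ball (0 : EuclideanSpace ℝ (Fin m)) R, φ z = 0) ∧ ∀ z, |φ z| ≤ 1 := by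
    intro k
    -- Including the complement of a ball in the zero set of the Urysohn function makes its support
    -- compact.
    have hs : IsClosed ((⋃ l, ⋃ _ : l ≠ k, X l) ∪
        (Metric.ball (0 : EuclideanSpace ℝ (Fin m)) R)ᶜ) := by
      refine IsClosed.union ?_ Metric.isOpen_ball.isClosed_compl
      exact isClosed_iUnion_of_finite fun l => isClosed_iUnion_of_finite fun _ => (hX l).isClosed
    have hdisj : Disjoint ((⋃ l, ⋃ _ : l ≠ k, X l) ∪
        (Metric.ball (0 : EuclideanSpace ℝ (Fin m)) R)ᶜ) (X k) := by
      rw [Set.disjoint_union_left]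
      refine ⟨?_, ?_⟩
      · simp only [Set.disjoint_iUnion_left]
        exact fun l hl => hd hl
      · rw [Set.disjoint_compl_left_iff_subset]
        exact (Set.subset_iUnion X k).trans hR
    obtain ⟨f, h0, h1, h⟩ := exists_contMDiffMap_zero_one_of_isClosed
      (modelWithCornersSelf ℝ (EuclideanSpace ℝ (Fin m))) (n := ⊤) hs (hX k).isClosed hdisj
    refine ⟨f, f.contMDiff.contDiff, fun z hz => h1 hz, fun l hl z hz => h0 (Or.inl ?_),
      fun z hz => h0 (Or.inr hz), fun z => ?_⟩
    · simp only [Set.mem_iUnion]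
      exact ⟨l, hl, hz⟩
    · rw [abs_of_nonneg (h z).1]
      exact (h z).2
  choose φ hφ h1 h0 hb hle using key
  refine ⟨fun z => ∑ k, v k * φ k z, ⟨?_, ?_⟩, ?_, ?_⟩
  · exact ContDiff.sum fun k _ => contDiff_const.mul (hφ k)
  · refine HasCompactSupport.of_support_subset_isCompact (isCompact_closedBall 0 R) fun z hz => ?_
    by_contra hcon
    refine hz (Finset.sum_eq_zero fun k _ => ?_)
    rw [hb k z fun h => hcon (Metric.ball_subset_closedBall h), mul_zero]
  · intro k z hz
    simp only
    rw [Finset.sum_eq_single k, h1 k z hz, mul_one]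
    · intro l _ hl
      rw [h0 l k hl.symm z hz, mul_zero]
    · simp
  · intro z
    refine (Finset.abs_sum_le_sum_abs _ _).trans (Finset.sum_le_sum fun k _ => ?_)
    rw [abs_mul]
    exact mul_le_of_le_one_right (abs_nonneg _) (hle k z)

theorem exists_separated_reals (κ : Type*) [Fintype κ] (r : ℝ) :
    ∃ M : κ → ℝ, ∀ k k', k ≠ k' → r < |M k - M k'| := by
  refine ⟨fun k => (|r| + 1) * (Fintype.equivFin κ k : ℕ), fun k k' h => ?_⟩
  have hne : ((Fintype.equivFin κ k : ℕ) : ℤ) - (Fintype.equivFin κ k' : ℕ) ≠ 0 := by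
    intro h0
    apply h
    apply (Fintype.equivFin κ).injective
    ext
    omega
  have h1 : (1 : ℝ) ≤ |((Fintype.equivFin κ k : ℕ) : ℝ) - (Fintype.equivFin κ k' : ℕ)| := by
    exact_mod_cast Int.one_le_abs hne
  rw [← mul_sub, abs_mul, abs_of_pos (by positivity : 0 < |r| + 1)]
  nlinarith [le_abs_self r, abs_nonneg r]

theorem isCompact_setOf_forall_coord_mem {S : Fin m → Set ℝ} (hS : ∀ l, IsCompact (S l)) :
    IsCompact {z : EuclideanSpace ℝ (Fin m) | ∀ l, z l ∈ S l} := by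
  convert (isCompact_univ_pi hS).image (PiLp.continuous_toLp 2 _)
  ext z
  exact ⟨fun h => ⟨WithLp.ofLp z, fun l _ => h l, rfl⟩,
    fun ⟨w, hw, hwz⟩ l => hwz ▸ hw l trivial⟩

theorem isCompact_setOf_coord_mem {i₀ : Fin m} {S : Set ℝ} (hS : IsCompact S) (L : ℝ) :
    IsCompact {z : EuclideanSpace ℝ (Fin m) | z i₀ ∈ S ∧ ∀ l, |z l| ≤ L} := by
  have h := (isCompact_setOf_forall_coord_mem (m := m) (S := fun _ => Set.Icc (-L) L)
    fun _ => isCompact_Icc).inter_left (hS.isClosed.preimage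
      (by fun_prop : Continuous fun z : EuclideanSpace ℝ (Fin m) => z i₀))
  convert h using 1
  ext z
  simp [abs_le]

/-- A function in `C_c^∞` of one coordinate (on a large box) taking prescribed values on the
translates `S i j + M j`, where the `M j` are far apart. -/
theorem exists_smooth_eq_on_translates {ι J : Type*} [Fintype ι] [Fintype J] (i₀ : Fin m)
    {S : ι → J → Set ℝ} {r : ℝ} (hS : ∀ i j, IsCompact (S i j))
    (hd : ∀ j, Pairwise (Function.onFun Disjoint fun i => S i j))
    (hr : ∀ i j, ∀ u ∈ S i j, |u| ≤ r) {M : J → ℝ}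
    (hM : ∀ j j', j ≠ j' → 2 * r < |M j - M j'|) (c : ι × J → ℝ) (L : ℝ) :
    ∃ f ∈ smoothCompactlySupported m,
      (∀ i j z, (∀ l, |z l| ≤ L) → z i₀ - M j ∈ S i j → f z = c (i, j)) ∧
      ∀ z, |f z| ≤ ∑ k, |c k| := by
  obtain ⟨f, hf, h1, h2⟩ := exists_smooth_eq_on_compacts
    (X := fun k : ι × J => {z : EuclideanSpace ℝ (Fin m) |
      z i₀ ∈ (fun u => u + M k.2) '' S k.1 k.2 ∧ ∀ l, |z l| ≤ L})
    (fun k => isCompact_setOf_coord_mem ((hS _ _).image (by fun_prop)) L)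
    (by
      rintro ⟨i, j⟩ ⟨i', j'⟩ hne
      refine Set.disjoint_left.2 ?_
      rintro z ⟨⟨u, hu, huz⟩, -⟩ ⟨⟨u', hu', huz'⟩, -⟩
      simp only at hu hu' huz huz'
      by_cases hj : j = j'
      · subst hj
        have hi : i ≠ i' := fun h => hne (by rw [h])
        have : u = u' := by linarith
        subst this
        exact Set.disjoint_left.1 (hd j hi) hu hu'
      · have h := hM j j' hj
        have h1 := abs_le.1 (hr _ _ u hu)
        have h2 := abs_le.1 (hr _ _ u' hu')
        refine absurd h (not_lt.2 (abs_le.2 ⟨?_, ?_⟩)) <;> linarith [h1.1, h1.2, h2.1, h2.2]) c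
  exact ⟨f, hf, fun i j z hz hzS => h1 (i, j) z ⟨⟨_, hzS, by simp⟩, hz⟩, h2⟩

/-- The isometry of `ℝ^(m+1)` that swaps coordinate `i₀` with the last one. -/
noncomputable def swapLast (i₀ : Fin m) :
    EuclideanSpace ℝ (Fin (m + 1)) ≃ₗᵢ[ℝ] EuclideanSpace ℝ (Fin (m + 1)) :=
  LinearIsometryEquiv.piLpCongrLeft 2 ℝ ℝ (Equiv.swap i₀.castSucc (Fin.last m))

theorem swapLast_apply (i₀ : Fin m) (x : EuclideanSpace ℝ (Fin (m + 1))) (k : Fin (m + 1)) :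
    swapLast i₀ x k = x (Equiv.swap i₀.castSucc (Fin.last m) k) := by
  simp [swapLast, LinearIsometryEquiv.piLpCongrLeft_apply, Equiv.piCongrLeft'_apply]

/-- The map adding to coordinate `i₀` a function of the other coordinates, written as a coupling
conjugated by a swap of coordinates. -/
noncomputable def coordShift (i₀ : Fin m) (t : EuclideanSpace ℝ (Fin m) → ℝ)
    (x : EuclideanSpace ℝ (Fin (m + 1))) : EuclideanSpace ℝ (Fin (m + 1)) :=
  swapLast i₀ (affineCoupling 0 t (swapLast i₀ x))

theorem coordShift_last (i₀ : Fin m) (t : EuclideanSpace ℝ (Fin m) → ℝ)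
    (x : EuclideanSpace ℝ (Fin (m + 1))) : coordShift i₀ t x (Fin.last m) = x (Fin.last m) := by
  simp [coordShift, swapLast_apply]

theorem coordShift_self (i₀ : Fin m) (t : EuclideanSpace ℝ (Fin m) → ℝ)
    (x : EuclideanSpace ℝ (Fin (m + 1))) :
    coordShift i₀ t x i₀.castSucc = x i₀.castSucc + t (firstCoords (swapLast i₀ x)) := by
  simp [coordShift, swapLast_apply]

theorem coordShift_of_ne {i₀ l : Fin m} (h : l ≠ i₀) (t : EuclideanSpace ℝ (Fin m) → ℝ)
    (x : EuclideanSpace ℝ (Fin (m + 1))) :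
    coordShift i₀ t x l.castSucc = x l.castSucc := by
  have h1 : Equiv.swap i₀.castSucc (Fin.last m) l.castSucc = l.castSucc :=
    Equiv.swap_apply_of_ne_of_ne (by simpa using h) (Fin.castSucc_ne_last l)
  simp [coordShift, swapLast_apply, h1]

theorem firstCoords_swapLast_self (i₀ : Fin m) (x : EuclideanSpace ℝ (Fin (m + 1))) :
    firstCoords (swapLast i₀ x) i₀ = x (Fin.last m) := by
  simp [swapLast_apply]

/-- One crude bound valid for all coordinates, so that it can be iterated along a composition. -/
theorem abs_affineCoupling_le {s t : EuclideanSpace ℝ (Fin m) → ℝ} {C r : ℝ}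
    (hs : ∀ z, |s z| ≤ C) (ht : ∀ z, |t z| ≤ C) {x : EuclideanSpace ℝ (Fin (m + 1))}
    (hx : ∀ k, |x k| ≤ r) (k : Fin (m + 1)) :
    |affineCoupling s t x k| ≤ Real.exp C * r + C := by
  have hr : 0 ≤ r := (abs_nonneg _).trans (hx 0)
  have hC : 0 ≤ C := (abs_nonneg _).trans (hs 0)
  refine Fin.lastCases ?_ (fun i => ?_) k
  · rw [affineCoupling_last]
    refine (abs_add_le _ _).trans (add_le_add ?_ (ht _))
    rw [abs_mul, Real.abs_exp, mul_comm]
    exact mul_le_mul (Real.exp_le_exp.2 ((le_abs_self _).trans (hs _))) (hx _) (abs_nonneg _)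
      (Real.exp_pos _).le
  · rw [affineCoupling_castSucc]
    nlinarith [hx i.castSucc, Real.one_le_exp hC]

theorem abs_coordShift_le {i₀ : Fin m} {t : EuclideanSpace ℝ (Fin m) → ℝ} {C r : ℝ}
    (ht : ∀ z, |t z| ≤ C) {x : EuclideanSpace ℝ (Fin (m + 1))}
    (hx : ∀ k, |x k| ≤ r) (k : Fin (m + 1)) :
    |coordShift i₀ t x k| ≤ Real.exp C * r + C := by
  rw [coordShift, swapLast_apply]
  refine abs_affineCoupling_le (fun _ => ?_) ht (fun k => ?_) _
  · simpa using (abs_nonneg _).trans (ht 0)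
  · rw [swapLast_apply]
    exact hx _

theorem swapLast_mem_affineTransforms (i₀ : Fin m) :
    (swapLast i₀ : EuclideanSpace ℝ (Fin (m + 1)) → EuclideanSpace ℝ (Fin (m + 1)))
      ∈ affineTransforms (m + 1) :=
  ⟨(swapLast i₀).toLinearEquiv, 0, by ext; simp⟩

theorem id_mem_affineTransforms (d : ℕ) : id ∈ affineTransforms d :=
  ⟨LinearEquiv.refl ℝ _, 0, by ext; simp⟩

/-- The swap opening a `coordShift` is the affine factor of the coupling before it, and the closing
swap is that of its own coupling. -/
theorem isINN_five_couplings {G : Set (EuclideanSpace ℝ (Fin m) → ℝ)} (h0 : 0 ∈ G) (i₀ : Fin m)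
    {a b s t b' a' : EuclideanSpace ℝ (Fin m) → ℝ} (ha : a ∈ G) (hb : b ∈ G) (hs : s ∈ G)
    (ht : t ∈ G) (hb' : b' ∈ G) (ha' : a' ∈ G) :
    IsINN (singleCoordACF G) fun x => affineCoupling 0 a' (coordShift i₀ b'
      (affineCoupling s t (coordShift i₀ b (affineCoupling 0 a x)))) := by
  have hP := swapLast_mem_affineTransforms i₀
  have hmem : ∀ {u v : EuclideanSpace ℝ (Fin m) → ℝ}, u ∈ G → v ∈ G →
      affineCoupling u v ∈ singleCoordACF G := fun hu hv => ⟨_, hu, _, hv, rfl⟩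
  exact (IsINN.cons (id_mem_affineTransforms _) (hmem h0 ha') <|
    .cons hP (hmem h0 hb') <| .cons hP (hmem hs ht) <| .cons hP (hmem h0 hb) <|
    .single hP (hmem h0 ha) :)

/-- Given finitely many affine maps `y ↦ y * exp (s i j) + t i j`, a network with smooth couplings
realizes `(x', y) ↦ (x', y * exp (s i j) + t i j)` on the products `X j × I i`,
within bounds that do not depend on the compact sets `X j` and `I i`. -/
theorem exists_INN_piecewise_affine {ι J : Type*} [Fintype ι] [Fintype J] (i₀ : Fin m)
    (s t : ι → J → ℝ) (r : ℝ) :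
    ∃ C, ∀ (X : J → Set (EuclideanSpace ℝ (Fin m))) (I : ι → Set ℝ),
      (∀ j, IsCompact (X j)) → Pairwise (Function.onFun Disjoint X) →
      (∀ j, ∀ z ∈ X j, |z i₀| ≤ r) → (∀ i, IsCompact (I i)) →
      Pairwise (Function.onFun Disjoint I) → (∀ i, ∀ y ∈ I i, |y| ≤ r) →
      (∀ j, Pairwise (Function.onFun Disjoint fun i =>
        (fun y => y * Real.exp (s i j) + t i j) '' I i)) →
      ∃ Φ, IsINN (singleCoordACF (smoothCompactlySupported m)) Φ ∧
        (∀ x, (∀ k, |x k| ≤ r) → ∀ k, |Φ x k| ≤ C) ∧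
        ∀ i j x, (∀ k, |x k| ≤ r) → firstCoords x ∈ X j → x (Fin.last m) ∈ I i →
          (∀ l : Fin m, Φ x l.castSucc = x l.castSucc) ∧
          Φ x (Fin.last m) = x (Fin.last m) * Real.exp (s i j) + t i j := by
  -- `ρ` bounds the last coordinate both before and after the affine maps, so a single family `M`
  -- separates the columns for encoding and for decoding.
  obtain ⟨ρ, hρr, hρ⟩ : ∃ ρ, r ≤ ρ ∧ ∀ i j y, |y| ≤ r → |y * Real.exp (s i j) + t i j| ≤ ρ := by
    refine ⟨|r| + ∑ k : ι × J, (|r| * Real.exp (s k.1 k.2) + |t k.1 k.2|),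
      (le_abs_self r).trans (le_add_of_nonneg_right
        (Finset.sum_nonneg fun _ _ => by positivity)), fun i j y hy => ?_⟩
    have h1 : |y * Real.exp (s i j) + t i j| ≤ |r| * Real.exp (s i j) + |t i j| := by
      refine (abs_add_le _ _).trans (add_le_add ?_ le_rfl)
      rw [abs_mul, Real.abs_exp]
      have := hy.trans (le_abs_self r)
      gcongr
    have h2 := Finset.single_le_sum
      (f := fun k : ι × J => |r| * Real.exp (s k.1 k.2) + |t k.1 k.2|)
      (fun _ _ => by positivity) (Finset.mem_univ (i, j))
    have := abs_nonneg r
    simp only at h2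
    linarith
  obtain ⟨M, hM⟩ := exists_separated_reals J (2 * ρ)
  obtain ⟨c, hc⟩ := exists_separated_reals (ι × J) (2 * r)
  -- Chosen so that `y + M j` is sent to `y * exp (s i j) + t i j + M j`.
  set t' : ι × J → ℝ := fun k => t k.1 k.2 + M k.2 - M k.2 * Real.exp (s k.1 k.2) with ht'
  -- A common bound for all coupling functions below, fixed before `X` and `I` are given.
  set C₀ : ℝ := ∑ j, |M j| + ∑ k, |c k| + ∑ k : ι × J, |s k.1 k.2| + ∑ k, |t' k| with hC₀
  have hn1 : 0 ≤ ∑ j, |M j| := Finset.sum_nonneg fun _ _ => abs_nonneg _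
  have hn2 : 0 ≤ ∑ k, |c k| := Finset.sum_nonneg fun _ _ => abs_nonneg _
  have hn3 : 0 ≤ ∑ k : ι × J, |s k.1 k.2| := Finset.sum_nonneg fun _ _ => abs_nonneg _
  have hn4 : 0 ≤ ∑ k, |t' k| := Finset.sum_nonneg fun _ _ => abs_nonneg _
  set b : ℝ → ℝ := fun r => Real.exp C₀ * r + C₀ with hb
  refine ⟨b (b (b (b (b r)))), fun X I hX hXd hXr hI hId hIr hsep => ?_⟩
  obtain ⟨fA, hfA, hfA1, hfA2⟩ := exists_smooth_eq_on_compacts hX hXd M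
  obtain ⟨fE, hfE, hfE1, hfE2⟩ := exists_smooth_eq_on_compacts hX hXd (fun j => -M j)
  obtain ⟨fB, hfB, hfB1, hfB2⟩ := exists_smooth_eq_on_translates i₀ (S := fun i _ => I i)
    (r := r) (fun i _ => hI i) (fun _ => hId) (fun i _ => hIr i)
    (fun j j' h => (by linarith : 2 * r ≤ 2 * ρ).trans_lt (hM j j' h)) c (b r)
  -- `fD` removes `c (i, j)` by reading the index off the transformed last coordinate, hence the
  -- disjointness of the images. The box has size `b (b (b r))` because three maps precede it.
  obtain ⟨fD, hfD, hfD1, hfD2⟩ := exists_smooth_eq_on_translates i₀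
    (S := fun i j => (fun y => y * Real.exp (s i j) + t i j) '' I i)
    (r := ρ) (fun i j => (hI i).image (by fun_prop)) hsep
    (fun i j u hu => by
      obtain ⟨y, hy, rfl⟩ := hu
      exact hρ i j y (hIr i y hy)) hM (fun k => -c k) (b (b (b r)))
  have hY : ∀ k : ι × J, IsCompact ((fun z => z + EuclideanSpace.single i₀ (c k)) '' X k.2) :=
    fun k => (hX _).image (by fun_prop)
  -- Even for equal `j` the translates are disjoint: the `c k` differ by more than twice the bound
  -- on coordinate `i₀`.
  have hYd : Pairwise (Function.onFun Disjoint fun k : ι × J =>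
      (fun z => z + EuclideanSpace.single i₀ (c k)) '' X k.2) := by
    intro k k' hne
    refine Set.disjoint_left.2 ?_
    rintro _ ⟨z, hz, rfl⟩ ⟨z', hz', hzz⟩
    have h := hc k k' hne
    have h0 : z' i₀ + c k' = z i₀ + c k := by
      simpa using congrArg (fun w : EuclideanSpace ℝ (Fin m) => w i₀) hzz
    have h1 := abs_le.1 (hXr _ z hz)
    have h2 := abs_le.1 (hXr _ z' hz')
    refine absurd h (not_lt.2 (abs_le.2 ⟨?_, ?_⟩)) <;> linarith [h1.1, h1.2, h2.1, h2.2]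
  obtain ⟨fS, hfS, hfS1, hfS2⟩ := exists_smooth_eq_on_compacts hY hYd (fun k => s k.1 k.2)
  obtain ⟨fT, hfT, hfT1, hfT2⟩ := exists_smooth_eq_on_compacts hY hYd t'
  simp only [abs_neg] at hfE2 hfD2
  have hA3 : ∀ z, |fA z| ≤ C₀ := fun z => (hfA2 z).trans (by rw [hC₀]; linarith)
  have hB3 : ∀ z, |fB z| ≤ C₀ := fun z => (hfB2 z).trans (by rw [hC₀]; linarith)
  have hS3 : ∀ z, |fS z| ≤ C₀ := fun z => (hfS2 z).trans (by rw [hC₀]; linarith)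
  have hT3 : ∀ z, |fT z| ≤ C₀ := fun z => (hfT2 z).trans (by rw [hC₀]; linarith)
  have hD3 : ∀ z, |fD z| ≤ C₀ := fun z => (hfD2 z).trans (by rw [hC₀]; linarith)
  have hE3 : ∀ z, |fE z| ≤ C₀ := fun z => (hfE2 z).trans (by rw [hC₀]; linarith)
  have h03 : ∀ z, |(0 : EuclideanSpace ℝ (Fin m) → ℝ) z| ≤ C₀ := fun z => by
    simpa using (abs_nonneg _).trans (hA3 0)
  have hbd1 : ∀ {x : EuclideanSpace ℝ (Fin (m + 1))}, (∀ k, |x k| ≤ r) →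
      ∀ k, |affineCoupling 0 fA x k| ≤ b r := fun hx => abs_affineCoupling_le h03 hA3 hx
  have hbd3 : ∀ {x : EuclideanSpace ℝ (Fin (m + 1))}, (∀ k, |x k| ≤ r) →
      ∀ k, |affineCoupling fS fT (coordShift i₀ fB (affineCoupling 0 fA x)) k| ≤ b (b (b r)) :=
    fun hx => abs_affineCoupling_le hS3 hT3 (abs_coordShift_le hB3 (hbd1 hx))
  refine ⟨_, isINN_five_couplings zero_mem_smoothCompactlySupported i₀ hfA hfB hfS hfT hfD hfE,
    fun x hx => abs_affineCoupling_le h03 hE3 (abs_coordShift_le hD3 (hbd3 hx)), ?_⟩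
  intro i j x hx hxX hxI
  have hb1 := hbd1 hx
  have hb3 := hbd3 hx
  set x₁ := affineCoupling 0 fA x with hx₁
  have e1l : x₁ (Fin.last m) = x (Fin.last m) + M j := by
    simp [hx₁, hfA1 j _ hxX]
  have e1c : ∀ l : Fin m, x₁ l.castSucc = x l.castSucc := fun l => by simp [hx₁]
  set x₂ := coordShift i₀ fB x₁ with hx₂
  have e2l : x₂ (Fin.last m) = x (Fin.last m) + M j := by rw [hx₂, coordShift_last, e1l]
  have hfBv : fB (firstCoords (swapLast i₀ x₁)) = c (i, j) := by
    refine hfB1 i j _ (fun l => ?_) ?_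
    · rw [firstCoords_apply, swapLast_apply]; exact hb1 _
    · rw [firstCoords_swapLast_self, e1l]; simpa using hxI
  have e2s : x₂ i₀.castSucc = x i₀.castSucc + c (i, j) := by
    rw [hx₂, coordShift_self, e1c, hfBv]
  have e2c : ∀ l, l ≠ i₀ → x₂ l.castSucc = x l.castSucc := fun l hl => by
    rw [hx₂, coordShift_of_ne hl, e1c]
  have hx₂Y : firstCoords x₂ ∈ (fun z => z + EuclideanSpace.single i₀ (c (i, j))) '' X j := by
    refine ⟨_, hxX, ?_⟩
    ext l
    by_cases hl : l = i₀
    · subst hl; simp [e2s]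
    · simp [e2c l hl, hl]
  set x₃ := affineCoupling fS fT x₂ with hx₃
  have e3c : ∀ l : Fin m, x₃ l.castSucc = x₂ l.castSucc := fun l => by simp [hx₃]
  have e3l : x₃ (Fin.last m) = x (Fin.last m) * Real.exp (s i j) + t i j + M j := by
    rw [hx₃, affineCoupling_last, hfS1 (i, j) _ hx₂Y, hfT1 (i, j) _ hx₂Y, e2l, ht']
    ring
  set x₄ := coordShift i₀ fD x₃ with hx₄
  have e4l : x₄ (Fin.last m) = x (Fin.last m) * Real.exp (s i j) + t i j + M j := by
    rw [hx₄, coordShift_last, e3l]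
  have hfDv : fD (firstCoords (swapLast i₀ x₃)) = -c (i, j) := by
    refine hfD1 i j _ (fun l => ?_) ?_
    · rw [firstCoords_apply, swapLast_apply]; exact hb3 _
    · rw [firstCoords_swapLast_self, e3l]
      exact ⟨_, hxI, by ring⟩
  have e4c : ∀ l : Fin m, x₄ l.castSucc = x l.castSucc := fun l => by
    by_cases hl : l = i₀
    · subst hl
      rw [hx₄, coordShift_self, e3c, e2s, hfDv]; ring
    · rw [hx₄, coordShift_of_ne hl, e3c, e2c l hl]
  have hx₄X : firstCoords x₄ ∈ X j := by
    have : firstCoords x₄ = firstCoords x := by ext l; simp [e4c]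
    rwa [this]
  refine ⟨fun l => by rw [affineCoupling_castSucc, e4c], ?_⟩
  rw [affineCoupling_last, hfE1 j _ hx₄X, e4l]
  simp

end Smooth

/-! ### Small neighbourhoods of a grid and `L^p` smallness -/

section Grid

open Filter Topology

/-- The points with a coordinate close to the grid `h * ℤ`, at relative distance less than `η`. -/
def nearGrid (d : ℕ) (h η : ℝ) : Set (EuclideanSpace ℝ (Fin d)) :=
  {x | ∃ k, Int.fract (x k / h) ∉ Set.Icc η (1 - η)}

theorem measurableSet_nearGrid (d : ℕ) (h η : ℝ) : MeasurableSet (nearGrid d h η) := by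
  have : nearGrid d h η = ⋃ k, (fun x : EuclideanSpace ℝ (Fin d) => Int.fract (x k / h)) ⁻¹'
      (Set.Icc η (1 - η))ᶜ := by
    ext x; simp [nearGrid]
  rw [this]
  refine MeasurableSet.iUnion fun k => measurableSet_Icc.compl.preimage ?_
  exact measurable_fract.comp (by fun_prop : Continuous _).measurable

theorem volume_setOf_coord_mem_countable {d : ℕ} (k : Fin d) {T : Set ℝ} (hT : T.Countable) :
    volume {x : EuclideanSpace ℝ (Fin d) | x k ∈ T} = 0 := by
  have h1 := (Measure.quasiMeasurePreserving_eval (fun _ : Fin d => (volume : Measure ℝ)) k).comp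
    (PiLp.volume_preserving_ofLp (Fin d)).quasiMeasurePreserving
  exact h1.preimage_null (hT.measure_zero volume)

/-- The sets decrease, and a point in all of them has a coordinate in `h * ℤ`; such points form a
null set. -/
theorem tendsto_measure_nearGrid {d : ℕ} {h : ℝ} (hh : 0 < h)
    (μ : Measure (EuclideanSpace ℝ (Fin d))) [IsFiniteMeasure μ] (hμ : μ ≪ volume) :
    Tendsto (fun n : ℕ => μ (nearGrid d h (1 / ((n : ℝ) + 2)))) atTop (𝓝 0) := by
  have hlim : Tendsto (fun n : ℕ => (1 : ℝ) / ((n : ℝ) + 2)) atTop (𝓝 0) := by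
    have := (tendsto_add_atTop_iff_nat 1).2 (tendsto_one_div_add_atTop_nhds_zero_nat (𝕜 := ℝ))
    refine this.congr fun n => ?_
    push_cast; ring_nf
  have hanti : Antitone fun n : ℕ => nearGrid d h (1 / ((n : ℝ) + 2)) := by
    rintro a b hab x ⟨k, hk⟩
    have hle : (1 : ℝ) / ((b : ℝ) + 2) ≤ 1 / ((a : ℝ) + 2) :=
      one_div_le_one_div_of_le (by positivity) (by gcongr)
    exact ⟨k, fun hk' => hk ⟨hle.trans hk'.1, hk'.2.trans (by linarith)⟩⟩
  have h1 := tendsto_measure_iInter_atTop (μ := μ)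
    (fun n : ℕ => (measurableSet_nearGrid d h (1 / ((n : ℝ) + 2))).nullMeasurableSet) hanti
    ⟨0, measure_ne_top _ _⟩
  have h0 : μ (⋂ n : ℕ, nearGrid d h (1 / ((n : ℝ) + 2))) = 0 := by
    refine hμ (measure_mono_null (t := ⋃ k : Fin d, {x : EuclideanSpace ℝ (Fin d) |
      x k ∈ Set.range fun j : ℤ => h * j}) ?_ (measure_iUnion_null fun k =>
        volume_setOf_coord_mem_countable k (Set.countable_range _)))
    intro x hx
    by_contra hcon
    have hfr : ∀ k, 0 < Int.fract (x k / h) := fun k => by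
      refine lt_of_le_of_ne (Int.fract_nonneg _) fun h0 => hcon (Set.mem_iUnion.2 ⟨k, ?_⟩)
      refine ⟨⌊x k / h⌋, ?_⟩
      have h2 := Int.floor_add_fract (x k / h)
      rw [← h0, add_zero] at h2
      simp only [h2]
      field_simp
    have hev : ∀ᶠ n : ℕ in atTop, ∀ k, Int.fract (x k / h) ∈
        Set.Icc ((1 : ℝ) / ((n : ℝ) + 2)) (1 - 1 / ((n : ℝ) + 2)) := by
      refine eventually_all.2 fun k => ?_
      have hlt : 0 < 1 - Int.fract (x k / h) := sub_pos.2 (Int.fract_lt_one _)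
      filter_upwards [hlim.eventually_lt_const (hfr k), hlim.eventually_lt_const hlt] with n h3 h4
      exact ⟨h3.le, by linarith⟩
    obtain ⟨n, hn⟩ := hev.exists
    obtain ⟨k, hk⟩ := Set.mem_iInter.1 hx n
    exact hk (hn k)
  rwa [h0] at h1

/-- A function that is small off small sets `B n` and uniformly bounded is small in `L^p`. -/
theorem exists_eLpNorm_lt {α E : Type*} [MeasurableSpace α] [NormedAddCommGroup E]
    (μ : Measure α) [IsFiniteMeasure μ] {p : ℝ} (hp : 1 ≤ p) {ε : ℝ} (hε : 0 < ε) :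
    ∃ e : ℝ, 0 < e ∧ ∀ (C : ℝ) (B : ℕ → Set α), 0 ≤ C → (∀ n, MeasurableSet (B n)) →
      Tendsto (fun n => μ (B n)) atTop (𝓝 0) →
      ∃ n, ∀ f : α → E, (∀ᵐ x ∂μ, ‖f x‖ ≤ e + (B n).indicator (fun _ => C) x) →
        eLpNorm f (ENNReal.ofReal p) μ < ENNReal.ofReal ε := by
  have hp0 : 0 < p := by linarith
  have hq0 : ENNReal.ofReal p ≠ 0 := by simpa using hp0
  have hqr : (ENNReal.ofReal p).toReal = p := ENNReal.toReal_ofReal hp0.le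
  set V : ℝ := (μ Set.univ ^ (1 / p)).toReal with hV
  have hVtop : μ Set.univ ^ (1 / p) ≠ ⊤ :=
    ENNReal.rpow_ne_top_of_nonneg (by positivity) (measure_ne_top _ _)
  have hV0 : 0 ≤ V := ENNReal.toReal_nonneg
  -- The uniform part and the part on `B n` each get `ε / 2`; `V + 1` avoids dividing by zero when
  -- `μ = 0`. The value precedes `C` because, in the application, `C` depends on the grid and thus
  -- on it.
  refine ⟨ε / (2 * (V + 1)), by positivity, fun C B hC hB hlim => ?_⟩
  have hlim' : Tendsto (fun n => ENNReal.ofReal C * μ (B n) ^ (1 / p)) atTop (𝓝 0) := by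
    have h1 := (ENNReal.continuous_rpow_const (y := 1 / p)).tendsto 0 |>.comp hlim
    rw [ENNReal.zero_rpow_of_pos (by positivity)] at h1
    simpa using ENNReal.Tendsto.const_mul h1 (Or.inr ENNReal.ofReal_ne_top)
  obtain ⟨n, hn⟩ := (hlim'.eventually_lt_const
    (ENNReal.ofReal_pos.2 (by positivity : 0 < ε / 2))).exists
  refine ⟨n, fun f hf => ?_⟩
  have hc : eLpNorm (fun _ : α => ε / (2 * (V + 1))) (ENNReal.ofReal p) μ
      ≤ ENNReal.ofReal (ε / 2) := by
    rw [eLpNorm_const' _ hq0 ENNReal.ofReal_ne_top, hqr, Real.enorm_eq_ofReal (by positivity),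
      ← ENNReal.ofReal_toReal hVtop, ← ENNReal.ofReal_mul (by positivity)]
    refine ENNReal.ofReal_le_ofReal ?_
    rw [← hV, div_mul_eq_mul_div, div_le_div_iff₀ (by positivity) (by positivity)]
    nlinarith
  calc eLpNorm f (ENNReal.ofReal p) μ
      ≤ eLpNorm ((fun _ => ε / (2 * (V + 1))) + (B n).indicator fun _ => C)
        (ENNReal.ofReal p) μ := eLpNorm_mono_ae_real hf
    _ ≤ eLpNorm (fun _ : α => ε / (2 * (V + 1))) (ENNReal.ofReal p) μ
        + eLpNorm ((B n).indicator fun _ => C) (ENNReal.ofReal p) μ :=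
      eLpNorm_add_le aestronglyMeasurable_const
        (aestronglyMeasurable_const.indicator (hB n)) (by simpa using hp)
    _ < ENNReal.ofReal (ε / 2) + ENNReal.ofReal (ε / 2) := by
      refine ENNReal.add_lt_add_of_le_of_lt (ne_top_of_le_ne_top ENNReal.ofReal_ne_top hc) hc
        (lt_of_le_of_lt ?_ hn)
      refine (eLpNorm_indicator_const_le _ _).trans ?_
      rw [hqr, Real.enorm_eq_ofReal hC]
    _ = ENNReal.ofReal ε := by
      rw [← ENNReal.ofReal_add (by positivity) (by positivity), add_halves]

end Grid

/-! ### Uniform continuity and monotonicity in the last coordinate -/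

section Homeo

variable {m : ℕ}

/-- Subtracting the last coordinate leaves a continuous function of compact support. -/
theorem uniformContinuous_last_of_mem_singleCoordHomeos
    {τ : EuclideanSpace ℝ (Fin (m + 1)) → EuclideanSpace ℝ (Fin (m + 1))}
    (hτ : τ ∈ singleCoordHomeos m) :
    UniformContinuous fun v : Fin (m + 1) → ℝ => τ (WithLp.toLp 2 v) (Fin.last m) := by
  obtain ⟨hτ, -, K, hK, hid⟩ := hτ
  have hc := hτ.continuous
  have h1 : UniformContinuous fun v : Fin (m + 1) → ℝ =>
      τ (WithLp.toLp 2 v) (Fin.last m) - v (Fin.last m) := by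
    refine HasCompactSupport.uniformContinuous_of_continuous ?_ (by fun_prop)
    refine HasCompactSupport.of_support_subset_isCompact
      (hK.image (PiLp.continuous_ofLp 2 fun _ : Fin (m + 1) => ℝ)) fun v hv => ?_
    by_contra hcon
    refine hv ?_
    simp only
    rw [hid _ fun h => hcon ⟨_, h, rfl⟩, sub_self]
  simpa using h1.add (Pi.uniformContinuous_proj (fun _ : Fin (m + 1) => ℝ) (Fin.last m))

/-- As `τ` fixes the other coordinates, its injectivity restricts to each vertical line, so the
function is strictly monotone one way or the other; being the identity for large `y`, it cannot
decrease. -/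
theorem strictMono_last_of_mem_singleCoordHomeos
    {τ : EuclideanSpace ℝ (Fin (m + 1)) → EuclideanSpace ℝ (Fin (m + 1))}
    (hτ : τ ∈ singleCoordHomeos m) (z : Fin m → ℝ) :
    StrictMono fun y : ℝ =>
      τ (WithLp.toLp 2 (Fin.snoc (α := fun _ => ℝ) z y)) (Fin.last m) := by
  have hcont : Continuous fun y : ℝ =>
      τ (WithLp.toLp 2 (Fin.snoc (α := fun _ => ℝ) z y)) (Fin.last m) := by
    refine (uniformContinuous_last_of_mem_singleCoordHomeos hτ).continuous.comp ?_
    exact Continuous.finSnoc continuous_const continuous_id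
  obtain ⟨hτ, hfix, K, hK, hid⟩ := hτ
  obtain ⟨R, hR⟩ := hK.exists_bound_of_continuousOn
    (f := fun x : EuclideanSpace ℝ (Fin (m + 1)) => x (Fin.last m)) (by fun_prop)
  have hbig : ∀ y, R < y →
      τ (WithLp.toLp 2 (Fin.snoc (α := fun _ => ℝ) z y)) (Fin.last m) = y := by
    intro y hy
    rw [hid]
    · simp
    · intro h
      have := (Real.le_norm_self _).trans (hR _ h)
      simp at this
      linarith
  have hinj : Function.Injective fun y : ℝ =>
      τ (WithLp.toLp 2 (Fin.snoc (α := fun _ => ℝ) z y)) (Fin.last m) := by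
    intro y y' h
    have h2 : τ (WithLp.toLp 2 (Fin.snoc (α := fun _ => ℝ) z y))
        = τ (WithLp.toLp 2 (Fin.snoc (α := fun _ => ℝ) z y')) := by
      ext k
      refine Fin.lastCases h (fun i => ?_) k
      rw [hfix, hfix]; simp
    have h3 := congrArg (fun x : EuclideanSpace ℝ (Fin (m + 1)) => x (Fin.last m))
      (hτ.injective h2)
    simpa using h3
  rcases hcont.strictMono_of_inj hinj with h | h
  · exact h
  · have h1 := h (by linarith : R + 1 < R + 2)
    simp only at h1
    rw [hbig _ (by linarith), hbig _ (by linarith)] at h1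
    linarith

end Homeo

/-! ### Interpolation on a grid and the main theorem -/

section Main

variable {m : ℕ}

/-- The affine map sending `a` to `A` and `a + h` to `B`, written with an exponential slope. -/
theorem mul_exp_log_add_eq {a h A B : ℝ} (hh : 0 < h) (hAB : A < B) (y : ℝ) :
    y * Real.exp (Real.log ((B - A) / h)) + (A - a * Real.exp (Real.log ((B - A) / h)))
      = A + (y - a) / h * (B - A) := by
  rw [Real.exp_log (div_pos (sub_pos.2 hAB) hh)]
  ring

/-- A map altering only the last coordinate of points is approximated, off a neighbourhood of a
grid, by networks with smooth couplings. -/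
theorem exists_INN_near_singleCoordHomeo (hm : 1 ≤ m)
    {τ : EuclideanSpace ℝ (Fin (m + 1)) → EuclideanSpace ℝ (Fin (m + 1))}
    (hτ : τ ∈ singleCoordHomeos m) {ε : ℝ} (hε : 0 < ε) (R : ℝ) :
    ∃ h : ℝ, 0 < h ∧ ∃ C, ∀ η : ℝ, 0 < η →
      ∃ Φ, IsINN (singleCoordACF (smoothCompactlySupported m)) Φ ∧
        ∀ x, (∀ k, |x k| ≤ R) → (∀ k, |Φ x k| ≤ C) ∧
          (x ∉ nearGrid (m + 1) h η → dist (τ x) (Φ x) ≤ ε) := by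
  classical
  obtain ⟨δ, hδ, huc⟩ := Metric.uniformContinuous_iff.1
    (uniformContinuous_last_of_mem_singleCoordHomeos hτ) ε hε
  set h : ℝ := δ / 2 with hh
  have h0 : 0 < h := by positivity
  -- Points of `[-R, R]` have cell index between `-N` and `N`; the last cell ends at `h * (N + 1)`,
  -- the radius used below.
  obtain ⟨N, hN⟩ := exists_nat_ge (R / h)
  rw [div_le_iff₀ h0] at hN
  let ι := Finset.Icc (-(N : ℤ)) N
  let T : (Fin m → ι) → ℝ → ℝ := fun j y =>
    τ (WithLp.toLp 2 (Fin.snoc (α := fun _ => ℝ) (fun l => h * ((j l : ℤ) : ℝ)) y)) (Fin.last m)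
  have hT : ∀ j, StrictMono (T j) := fun j => strictMono_last_of_mem_singleCoordHomeos hτ _
  have hlt : ∀ i : ι, h * ((i : ℤ) : ℝ) < h * (((i : ℤ) : ℝ) + 1) := fun i =>
    mul_lt_mul_of_pos_left (lt_add_one _) h0
  let s : ι → (Fin m → ι) → ℝ := fun i j =>
    Real.log ((T j (h * (((i : ℤ) : ℝ) + 1)) - T j (h * ((i : ℤ) : ℝ))) / h)
  let t : ι → (Fin m → ι) → ℝ := fun i j =>
    T j (h * ((i : ℤ) : ℝ)) - h * ((i : ℤ) : ℝ) * Real.exp (s i j)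
  have hst : ∀ i j y, y * Real.exp (s i j) + t i j = T j (h * ((i : ℤ) : ℝ)) +
      (y - h * ((i : ℤ) : ℝ)) / h *
        (T j (h * (((i : ℤ) : ℝ) + 1)) - T j (h * ((i : ℤ) : ℝ))) :=
    fun i j y => mul_exp_log_add_eq h0 (hT j (hlt i)) y
  obtain ⟨C, hC⟩ := exists_INN_piecewise_affine (⟨0, hm⟩ : Fin m) s t (h * (N + 1))
  refine ⟨h, h0, C, fun η hη => ?_⟩
  -- Shrinking by `η > 0` makes the closed cells disjoint; what is lost lies in `nearGrid`.
  let I : ℤ → Set ℝ := fun i => Set.Icc (h * (i + η)) (h * (i + 1 - η))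
  have hmemI : ∀ {i : ℤ} {y : ℝ}, y ∈ I i → h * i < y ∧ y < h * (i + 1) := fun {i y} hy =>
    ⟨lt_of_lt_of_le (by nlinarith) hy.1, lt_of_le_of_lt hy.2 (by nlinarith)⟩
  have hId : ∀ i i', i ≠ i' → Disjoint (I i) (I i') := by
    have key : ∀ i i' : ℤ, i < i' → ∀ y ∈ I i, y ∉ I i' := by
      intro i i' hlt y hy hy'
      have h1 := (hmemI hy').1.trans (hmemI hy).2
      have h2 := lt_of_mul_lt_mul_left h1 h0.le
      have h3 : (i : ℝ) + 1 ≤ i' := by exact_mod_cast hlt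
      linarith
    intro i i' hne
    refine Set.disjoint_left.2 fun y hy hy' => ?_
    rcases lt_or_gt_of_ne hne with hl | hl
    · exact key _ _ hl y hy hy'
    · exact key _ _ hl y hy' hy
  have hIr : ∀ i : ι, ∀ y ∈ I i, |y| ≤ h * (N + 1) := by
    rintro ⟨i, hi⟩ y hy
    obtain ⟨h1, h2⟩ := Finset.mem_Icc.1 hi
    have h1' : -(N : ℝ) ≤ i := by exact_mod_cast h1
    have h2' : (i : ℝ) ≤ N := by exact_mod_cast h2
    obtain ⟨h3, h4⟩ := hmemI hy
    simp only at h3 h4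
    rw [abs_le]
    constructor <;> nlinarith
  obtain ⟨Φ, hΦ, hΦC, hΦv⟩ := hC (fun j => {z | ∀ l, z l ∈ I (j l)}) (fun i => I i)
    (fun j => isCompact_setOf_forall_coord_mem fun _ => isCompact_Icc)
    (by
      intro j j' hne
      obtain ⟨l, hl⟩ := Function.ne_iff.1 hne
      exact Set.disjoint_left.2 fun z hz hz' => Set.disjoint_left.1
        (hId _ _ fun h => hl (Subtype.ext h)) (hz l) (hz' l))
    (fun j z hz => hIr _ _ (hz _)) (fun i => isCompact_Icc)
    (fun i i' hne => hId _ _ fun h => hne (Subtype.ext h)) hIr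
    (by
      intro j
      -- Interpolated values on a shrunk cell lie strictly between the endpoint values of the
      -- increasing `T j`, so distinct cells have disjoint images.
      have hval : ∀ i : ι, ∀ y ∈ I i, T j (h * ((i : ℤ) : ℝ)) < y * Real.exp (s i j) + t i j ∧
          y * Real.exp (s i j) + t i j < T j (h * (((i : ℤ) : ℝ) + 1)) := by
        intro i y hy
        obtain ⟨h1, h2⟩ := hmemI hy
        have h3 : 0 < (y - h * ((i : ℤ) : ℝ)) / h := div_pos (by linarith) h0
        have h4 : (y - h * ((i : ℤ) : ℝ)) / h < 1 := by
          rw [div_lt_one h0]; linarith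
        have h5 := hT j (hlt i)
        rw [hst]
        constructor <;> nlinarith
      have key : ∀ i i' : ι, (i : ℤ) < i' → ∀ y ∈ I i, ∀ y' ∈ I i',
          y * Real.exp (s i j) + t i j ≠ y' * Real.exp (s i' j) + t i' j := by
        intro i i' hlt y hy y' hy'
        have h1 : (((i : ℤ) : ℝ)) + 1 ≤ ((i' : ℤ) : ℝ) := by exact_mod_cast hlt
        have h2 := (hT j).monotone (mul_le_mul_of_nonneg_left h1 h0.le)
        exact ((hval i y hy).2.trans_le h2 |>.trans (hval i' y' hy').1).ne
      intro i i' hne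
      refine Set.disjoint_left.2 ?_
      rintro _ ⟨y, hy, rfl⟩ ⟨y', hy', hyy⟩
      rcases lt_or_gt_of_ne (fun h => hne (Subtype.ext h) : (i : ℤ) ≠ i') with hl | hl
      · exact key _ _ hl y hy y' hy' hyy.symm
      · exact key _ _ hl y' hy' y hy hyy)
  refine ⟨Φ, hΦ, fun x hx => ?_⟩
  have hx' : ∀ k, |x k| ≤ h * (N + 1) := fun k => (hx k).trans (by nlinarith)
  refine ⟨hΦC x hx', fun hgood => ?_⟩
  have hfl : ∀ k, ⌊x k / h⌋ ∈ ι := fun k => by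
    obtain ⟨h1, h2⟩ := abs_le.1 (hx k)
    refine Finset.mem_Icc.2 ⟨Int.le_floor.2 ?_, Int.cast_le (R := ℝ).1 ((Int.floor_le _).trans ?_)⟩
    · rw [le_div_iff₀ h0]; push_cast; linarith
    · rw [div_le_iff₀ h0]; push_cast; linarith
  have hcell : ∀ k, x k ∈ I ⌊x k / h⌋ := fun k => by
    have h1 : Int.fract (x k / h) ∈ Set.Icc η (1 - η) := by
      by_contra hcon
      exact hgood ⟨k, hcon⟩
    have h2 := Int.floor_add_fract (x k / h)
    rw [eq_div_iff h0.ne'] at h2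
    obtain ⟨h3, h4⟩ := h1
    constructor <;> nlinarith
  set i : ι := ⟨_, hfl (Fin.last m)⟩ with hi
  set j : Fin m → ι := fun l => ⟨_, hfl l.castSucc⟩ with hj
  obtain ⟨hfix, hlast⟩ := hΦv i j x hx' (fun l => hcell l.castSucc) (hcell (Fin.last m))
  rw [dist_eq_abs_sub_last fun l => by rw [hfix, hτ.2.1]]
  have hclose : ∀ y, |x (Fin.last m) - y| ≤ h → |τ x (Fin.last m) - T j y| < ε := by
    intro y hy
    have := @huc (WithLp.ofLp x) (Fin.snoc (α := fun _ => ℝ) (fun l => h * ((j l : ℤ) : ℝ)) y) ?_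
    · simpa [Real.dist_eq] using this
    · refine lt_of_le_of_lt ((dist_pi_le_iff h0.le).2 fun k => ?_) (by linarith : h < δ)
      refine Fin.lastCases ?_ (fun l => ?_) k
      · simpa [Real.dist_eq] using hy
      · rw [Fin.snoc_castSucc, Real.dist_eq, abs_le]
        have h1 := hmemI (hcell l.castSucc)
        simp only [hj]
        constructor <;> linarith [h1.1, h1.2]
  obtain ⟨h1, h2⟩ := hmemI (hcell (Fin.last m))
  have hlo := abs_lt.1 (hclose (h * ((i : ℤ) : ℝ)) (by
    rw [abs_le]; constructor <;> linarith))
  have hhi := abs_lt.1 (hclose (h * (((i : ℤ) : ℝ) + 1)) (by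
    rw [abs_le]; constructor <;> linarith))
  have h3 : 0 ≤ (x (Fin.last m) - h * ((i : ℤ) : ℝ)) / h := div_nonneg (by linarith) h0.le
  have h4 : (x (Fin.last m) - h * ((i : ℤ) : ℝ)) / h ≤ 1 := by
    rw [div_le_one h0]; linarith
  have h5 := (hT j (hlt i)).le
  -- The value of `Φ` is a convex combination of two values of `T j`, each within `ε` of the last
  -- coordinate of `τ x`.
  rw [hlast, hst, abs_le]
  constructor <;> nlinarith

theorem norm_le_of_forall_abs_le {d : ℕ} {x : EuclideanSpace ℝ (Fin d)} {C : ℝ}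
    (hx : ∀ k, |x k| ≤ C) : ‖x‖ ≤ √d * |C| := by
  rw [EuclideanSpace.norm_eq, ← Real.sqrt_sq_eq_abs, ← Real.sqrt_mul (Nat.cast_nonneg _)]
  refine Real.sqrt_le_sqrt ?_
  calc ∑ k, ‖x k‖ ^ 2 ≤ ∑ _k : Fin d, C ^ 2 := by
        gcongr with k
        exact hx k
    _ = _ := by simp

end Main

/-- The dimension is `d = m + 1 ≥ 2`. -/
theorem theorem2 (m : ℕ) (hm : 1 ≤ m) (p : ℝ) (hp : 1 ≤ p)
    (H : Set (EuclideanSpace ℝ (Fin m) → ℝ))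
    (hH_univ : IsSupUniversal H (smoothCompactlySupported m))
    (hH_pw : ∀ h ∈ H, IsPiecewiseC1 h) :
    IsLpUniversal p (INN (singleCoordACF H)) (singleCoordHomeos m) := by
  refine ⟨fun g hg => IsINN.measurable ?_ hg, fun τ hτ ε hε K hK => ?_⟩
  · rintro _ ⟨s, hs, t, ht, rfl⟩
    exact measurable_affineCoupling (hH_univ.1 s hs) (hH_univ.1 t ht)
  have : IsFiniteMeasure (volume.restrict K) := ⟨by simpa using hK.measure_lt_top⟩
  obtain ⟨e, he, hLp⟩ := exists_eLpNorm_lt (E := EuclideanSpace ℝ (Fin (m + 1)))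
    (volume.restrict K) hp hε
  obtain ⟨R, hR⟩ := hK.exists_bound_of_continuousOn continuous_id.continuousOn
  obtain ⟨R', hR'⟩ := hK.exists_bound_of_continuousOn hτ.1.continuous.continuousOn
  -- Half of `e` is spent on `Φ` away from the grid, the other half on passing from `Φ` to `g` on
  -- all of `K`.
  obtain ⟨h, h0, C, hC⟩ := exists_INN_near_singleCoordHomeo hm hτ (half_pos he) R
  set C' : ℝ := |R'| + √(m + 1 : ℕ) * |C| with hC'
  obtain ⟨n, hn⟩ := hLp C' (fun n => nearGrid (m + 1) h (1 / ((n : ℝ) + 2))) (by positivity)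
    (fun n => measurableSet_nearGrid _ _ _)
    (tendsto_measure_nearGrid h0 _ Measure.restrict_le_self.absolutelyContinuous)
  obtain ⟨Φ, hΦ, hΦx⟩ := hC (1 / ((n : ℝ) + 2)) (by positivity)
  obtain ⟨g, hg, hgΦ⟩ := exists_INN_approx hH_univ hΦ K hK (e / 2) (half_pos he)
  refine ⟨g, hg, hn _ ?_⟩
  filter_upwards [ae_restrict_mem hK.measurableSet] with x hx
  have hxR : ∀ k, |x k| ≤ R := fun k => (PiLp.norm_apply_le x k).trans (hR x hx)
  obtain ⟨h1, h2⟩ := hΦx x hxR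
  have h3 : dist (τ x) (g x) ≤ dist (τ x) (Φ x) + e / 2 :=
    (dist_triangle _ _ _).trans (add_le_add le_rfl (hgΦ x hx))
  rw [← dist_eq_norm]
  by_cases hxn : x ∈ nearGrid (m + 1) h (1 / ((n : ℝ) + 2))
  · rw [Set.indicator_of_mem hxn]
    have h4 : dist (τ x) (Φ x) ≤ C' := by
      rw [dist_eq_norm]
      refine (norm_sub_le _ _).trans (add_le_add ((hR' x hx).trans (le_abs_self _)) ?_)
      exact norm_le_of_forall_abs_le h1
    linarith
  · rw [Set.indicator_of_notMem hxn]
    linarith [h2 hxn]
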